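/- A Grand-Dyck path is a lattice path with equally many upsteps $U=(1,1)$ and downsteps $D=(1,-1)$; its size is the number of upsteps, and ground level is the horizontal line through its endpoints. A low peak is an occurrence of $UD$ that starts at ground level. A Dyck path is a Grand-Dyck path that never goes below ground level. An ordered pair of compositions $n=b_1+\cdots+b_k=b_1'+\cdots+b_k'$ into the same (unspecified) number $k$ of positive parts is irreducible if there is no $j$ with $0<j<k$ and $b_1+\cdots+b_j=b_1'+\cdots+b_j'$. (i) For every $n\ge 0$, the number of irreducible ordered pairs of compositions of $n+1$ equals the (finite) number of Grand-Dyck paths of size $n$ without low peaks. (ii) Both sequences, indexed by $n \ge 0$, have the ordinary generating function $$\frac{1}{x+\sqrt{1-4x}},$$ where $\sqrt{1-4x}$ is the formal power series with constant term $1$ whose square is $1-4x$. (iii) A parallelogram polyomino of semiperimeter $k\ge 2$ is given by two lattice paths with $k$ unit North and East steps each (its upper and lower boundary), with the same starting point and the same endpoint, the upper path lying strictly above the lower one in between. There is a map $\delta$ that, for every $k\ge2$, sends the parallelogram polyominoes of semiperimeter $k$ bijectively to the Dyck paths of size $k-1$. Let $\delta$ be any such map, and fix one of the colours blue and red. Given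 an irreducible ordered pair of compositions of $n+1$, draw a blue lattice path for the first and a red one for the second composition from the same starting point, where an entry $a$ contributes $a-1$ North steps followed by one East step, and omit the last (East) step of each path. The common vertices of the two paths split the diagram into parallelogram polyominoes and degenerate pieces consisting of two coincident North steps. Replace a polyomino $P$ by the primitive Dyck path $U\,\delta(P)\,D$ if its upper path has the fixed colour, and by the reflection of $U\,\delta(P)\,D$ in ground level otherwise; replace a degenerate piece by $DU$. Concatenating the resulting paths in order defines, for every $n\ge0$, a bijection from the irreducible ordered pairs of compositions of $n+1$ to the Grand-Dyck paths of size $n$ without low peaks. -/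

import Mathlib

namespace LatticePairs

/-! ### Grand-Dyck paths -/

/-- A lattice path of up- and downsteps is a Grand-Dyck path if it has as many `U` as `D`. -/
def IsGrandDyck (p : List DyckStep) : Prop :=
  p.count DyckStep.U = p.count DyckStep.D

/-- A low peak is an occurrence of `UD` that starts at ground level. -/
def HasLowPeak (p : List DyckStep) : Prop :=
  ∃ a b : List DyckStep,
    p = a ++ [DyckStep.U, DyckStep.D] ++ b ∧ a.count DyckStep.U = a.count DyckStep.D

/-- The Grand-Dyck paths of size `n` (that is, with `n` upsteps) without low peaks. -/
def lowPeakFreePaths (n : ℕ) : Set (List DyckStep) :=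
  {p | IsGrandDyck p ∧ p.count DyckStep.U = n ∧ ¬ HasLowPeak p}

/-- Reflection in ground level of a single step. -/
def flipStep : DyckStep → DyckStep
  | DyckStep.U => DyckStep.D
  | DyckStep.D => DyckStep.U

/-- Reflection of a path in ground level. -/
def flipPath (p : List DyckStep) : List DyckStep := p.map flipStep

/-! ### Irreducible pairs of compositions -/

/-- The irreducible ordered pairs of compositions of `n`: the same number of parts, and no two
partial sums with the same number of terms agree, except the empty and the full ones. -/
def irreduciblePairs (n : ℕ) : Set (Composition n × Composition n) :=
  {c | c.1.length = c.2.length ∧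
    ∀ j, 0 < j → j < c.1.length → c.1.sizeUpTo j ≠ c.2.sizeUpTo j}

/-! ### Paths of North and East steps, parallelogram polyominoes -/

/-- Unit steps North and East. -/
inductive NEStep
  | N
  | E
  deriving DecidableEq

/-- The lattice path of a composition: the entry `a` contributes `a - 1` North steps followed by
one East step. -/
def compositionPath {n : ℕ} (c : Composition n) : List NEStep :=
  c.blocks.flatMap fun a => List.replicate (a - 1) NEStep.N ++ [NEStep.E]

/-- `p` and `q` are the upper and the lower boundary path of a (nondegenerate) parallelogram
polyomino: they have the same endpoints, and strictly in between `p` is strictly above `q`.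
After `i` steps both paths are on the same antidiagonal, so they are compared by the number of
North steps made so far. -/
def IsParallelogram (p q : List NEStep) : Prop :=
  p.length = q.length ∧ 2 ≤ p.length ∧ p.count NEStep.N = q.count NEStep.N ∧
    ∀ i < p.length, 0 < i → (q.take i).count NEStep.N < (p.take i).count NEStep.N

instance (p q : List NEStep) : Decidable (IsParallelogram p q) := by
  unfold IsParallelogram; infer_instance

/-- Parallelogram polyominoes, given by their upper and lower boundary paths. -/
structure ParallelogramPolyomino where
  upper : List NEStep
  lower : List NEStep
  isParallelogram : IsParallelogram upper lower

/-- The semiperimeter is the length of either boundary path. -/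
def ParallelogramPolyomino.semiperimeter (P : ParallelogramPolyomino) : ℕ := P.upper.length

/-- `δ` maps, for every `k ≥ 2`, the parallelogram polyominoes of semiperimeter `k` bijectively
to the Dyck paths of size `k - 1`. -/
def IsPolyominoBijection (δ : ParallelogramPolyomino → DyckWord) : Prop :=
  ∀ k, 2 ≤ k → Set.BijOn δ {P | P.semiperimeter = k} {w | w.semilength = k - 1}

/-! ### The map from pairs of compositions to Grand-Dyck paths -/

/-- Auxiliary to `splitAtCommon`: `acc` holds the steps made since the last common vertex. -/
def splitAux : List (NEStep × NEStep) → List (NEStep × NEStep) →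
    List (List NEStep × List NEStep)
  | acc, [] => if acc = [] then [] else [acc.unzip]
  | acc, s :: l =>
    if ((acc ++ [s]).map Prod.fst).count NEStep.N = ((acc ++ [s]).map Prod.snd).count NEStep.N then
      (acc ++ [s]).unzip :: splitAux [] l
    else splitAux (acc ++ [s]) l

/-- Split two paths of the same length with the same starting point at all their common
vertices. -/
def splitAtCommon (p q : List NEStep) : List (List NEStep × List NEStep) :=
  splitAux [] (p.zip q)

/-- The colours of the two paths of a pair: the first is blue, the second is red. -/
inductive Colour
  | blue
  | red
  deriving DecidableEq

/-- The primitive Dyck path of a polyomino (its Dyck path, elevated), flipped over unless the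
colour `c` of the upper path is the colour `keep`. -/
def polyominoComponent (δ : ParallelogramPolyomino → DyckWord) (keep c : Colour)
    (P : ParallelogramPolyomino) : List DyckStep :=
  if c = keep then (δ P).nest.toList else flipPath (δ P).nest.toList

/-- The component that belongs to a piece between consecutive common vertices of the blue path
and the red path. The last case is the degenerate polyomino of two coincident North steps, with
Dyck path `UD`, which is always flipped over. -/
def pieceComponent (δ : ParallelogramPolyomino → DyckWord) (keep : Colour)
    (s : List NEStep × List NEStep) : List DyckStep :=
  if h : IsParallelogram s.1 s.2 then polyominoComponent δ keep Colour.blue ⟨s.1, s.2, h⟩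
  else if h : IsParallelogram s.2 s.1 then polyominoComponent δ keep Colour.red ⟨s.2, s.1, h⟩
  else flipPath [DyckStep.U, DyckStep.D]

/-- The path of a pair of compositions: omit the last (East) step of both lattice paths, split at
the common vertices, turn each piece into a component, and concatenate. -/
def pairToPath (δ : ParallelogramPolyomino → DyckWord) (keep : Colour) {n : ℕ}
    (c : Composition n × Composition n) : List DyckStep :=
  (splitAtCommon (compositionPath c.1).dropLast (compositionPath c.2).dropLast).flatMap
    (pieceComponent δ keep)

end LatticePairs

namespace LatticePairs

/-! ### Factorization of balanced words into primitive ones -/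

section Factorization

variable {A : Type*}

/-! Both sides are words over a weighted alphabet, of weight zero, that avoid a fixed primitive
factor at level zero. On the composition side the letters are the pairs of simultaneous steps of the
two truncated paths, and the weight is the change of their height difference. The paths have equal
length, so equal numbers of parts means weight zero, and a common partial sum is a letter `(E, E)`
read at level zero (`bijOn_pairWord`). On the Grand-Dyck side the letters are steps, and the avoided
factor is `UD` (`lowPeakFreePaths_eq`).

A word of weight zero factors uniquely at its returns to level zero into primitive words. The
avoided factor is itself primitive, so avoiding it at level zero means that it is absent from the
factorization (`bijOn_flatten`). It therefore suffices to match primitive words of length `k` other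
than `(E, E)` with primitive words of length `2 * k` other than `UD` (`bijOn_pieceComponent`). For
`k = 1` the only words left are `(N, N)` and `DU`. For `k ≥ 2`, weights of absolute value at most 1
keep a primitive word on one side of level zero. It is then a polyomino with a colour for its upper
path, or an elevated Dyck path with a choice of reflection, and `δ` matches the two.

A suitable `δ` interleaves the upper boundary with the exchanged lower one and strips the outer
steps. For the generating function, with `C` the Catalan series, primitive paths other than `UD` are
counted by `X * (2 * C - 1)`. Hence the series `F` of paths satisfies `F = 1 + X * (2 * C - 1) * F`,
and `1 - 2 * X * C` is the required square root of `1 - 4 * X`. -/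

/-- The total weight of a word. -/
def weight (w : A → ℤ) (l : List A) : ℤ := (l.map w).sum

@[simp] lemma weight_nil (w : A → ℤ) : weight w [] = 0 := rfl

@[simp] lemma weight_cons (w : A → ℤ) (a : A) (l : List A) :
    weight w (a :: l) = w a + weight w l := by simp [weight]

@[simp] lemma weight_append (w : A → ℤ) (l m : List A) :
    weight w (l ++ m) = weight w l + weight w m := by simp [weight]

/-- A nonempty word of weight zero none of whose proper nonempty prefixes has weight zero. -/
def IsPrimitive (w : A → ℤ) (l : List A) : Prop :=
  l ≠ [] ∧ weight w l = 0 ∧ ∀ a b, l = a ++ b → a ≠ [] → b ≠ [] → weight w a ≠ 0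

lemma IsPrimitive.eq_nil_of_append {w : A → ℤ} {s c : List A} (hs : IsPrimitive w s)
    (h : IsPrimitive w (s ++ c)) : c = [] := by
  by_contra hc
  exact h.2.2 s c rfl hs.1 hc hs.2.1

lemma weight_flatten {w : A → ℤ} {L : List (List A)} (hL : ∀ s ∈ L, IsPrimitive w s) :
    weight w L.flatten = 0 := by
  induction L with
  | nil => simp
  | cons s L ih =>
    simp only [List.mem_cons, forall_eq_or_imp] at hL
    simp [hL.1.2.1, ih hL.2]

/-- Primitive words form a prefix code: of the two first factors one is a prefix of the other, so
they coincide and can be cancelled. -/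
lemma flatten_injOn_primitive {w : A → ℤ} : ∀ {L M : List (List A)},
    (∀ s ∈ L, IsPrimitive w s) → (∀ s ∈ M, IsPrimitive w s) → L.flatten = M.flatten → L = M
  | [], [], _, _, _ => rfl
  | [], t :: M, _, hM, h => by
    have := (hM t (by simp)).1
    simp_all
  | s :: L, [], hL, _, h => by
    have := (hL s (by simp)).1
    simp_all
  | s :: L, t :: M, hL, hM, h => by
    simp only [List.mem_cons, forall_eq_or_imp] at hL hM
    simp only [List.flatten_cons] at h
    have key : s = t := by
      rcases List.append_eq_append_iff.1 h with ⟨c, rfl, -⟩ | ⟨c, rfl, -⟩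
      · simp [hL.1.eq_nil_of_append hM.1]
      · simp [hM.1.eq_nil_of_append hL.1]
    subst key
    rw [flatten_injOn_primitive hL.2 hM.2 (List.append_cancel_left h)]

/-- The shortest nonempty prefix of weight zero is primitive by minimality. -/
lemma exists_primitive_append {w : A → ℤ} {l : List A} (hl : l ≠ []) (h : weight w l = 0) :
    ∃ s m, l = s ++ m ∧ IsPrimitive w s := by
  classical
  have hex : ∃ i, 0 < i ∧ weight w (l.take i) = 0 :=
    ⟨l.length, List.length_pos_iff.2 hl, by simpa using h⟩
  have hspec := Nat.find_spec hex
  set i := Nat.find hex with hi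
  refine ⟨l.take i, l.drop i, (List.take_append_drop _ _).symm, ?_, hspec.2, ?_⟩
  · simp [hl, hspec.1.ne']
  · intro a b hab ha hb h0
    have hlen := congrArg List.length hab
    have hb' := List.length_pos_iff.2 hb
    simp only [List.length_take, List.length_append] at hlen
    refine Nat.find_min hex (m := a.length) (by omega) ⟨List.length_pos_iff.2 ha, ?_⟩
    have : l.take a.length = a := by
      have h1 : (l.take i).take a.length = a := by rw [hab]; simp
      rwa [List.take_take, min_eq_left (by omega)] at h1
    rw [this, h0]

lemma exists_flatten_primitive {w : A → ℤ} (l : List A) (h : weight w l = 0) :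
    ∃ L : List (List A), (∀ s ∈ L, IsPrimitive w s) ∧ L.flatten = l := by
  by_cases hl : l = []
  · exact ⟨[], by simp, by simp [hl]⟩
  · obtain ⟨s, m, rfl, hs⟩ := exists_primitive_append hl h
    have hlt : m.length < (s ++ m).length := by
      simpa using List.length_pos_iff.2 hs.1
    obtain ⟨L, hL, rfl⟩ := exists_flatten_primitive m (by simpa [hs.2.1] using h)
    exact ⟨s :: L, by simpa using ⟨hs, hL⟩, by simp⟩
termination_by l.length

/-! ### Avoiding a primitive word at level zero -/

/-- The words of length `n` and weight zero without an occurrence of `t` at level zero. -/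
def avoidingWords (w : A → ℤ) (t : List A) (n : ℕ) : Set (List A) :=
  {l | l.length = n ∧ weight w l = 0 ∧ ¬ ∃ a b, l = a ++ t ++ b ∧ weight w a = 0}

/-- The primitive words of length `n` other than `t`. -/
def primitiveWords (w : A → ℤ) (t : List A) (n : ℕ) : Set (List A) :=
  {s | IsPrimitive w s ∧ s ≠ t ∧ s.length = n}

/-- The sequences of primitive words other than `t`, of total length `n`. -/
def primitiveSeqs (w : A → ℤ) (t : List A) (n : ℕ) : Set (List (List A)) :=
  {L | (∀ s ∈ L, IsPrimitive w s ∧ s ≠ t) ∧ L.flatten.length = n}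

/-- If `t` occurs at level zero, the parts before and after it have weight zero and factor into
primitive words. Uniqueness of the factorization then makes `t` one of the factors. -/
lemma exists_append_iff_mem {w : A → ℤ} {t : List A} (ht : IsPrimitive w t) {L : List (List A)}
    (hL : ∀ s ∈ L, IsPrimitive w s) :
    (∃ a b, L.flatten = a ++ t ++ b ∧ weight w a = 0) ↔ t ∈ L := by
  constructor
  · rintro ⟨a, b, h, ha⟩
    have hb : weight w b = 0 := by
      have := weight_flatten hL
      rw [h] at this
      simpa [ha, ht.2.1] using this
    obtain ⟨La, hLa, rfl⟩ := exists_flatten_primitive a ha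
    obtain ⟨Lb, hLb, rfl⟩ := exists_flatten_primitive b hb
    have : L = La ++ t :: Lb := by
      apply flatten_injOn_primitive hL
      · simp only [List.mem_append, List.mem_cons]
        rintro s (hs | rfl | hs)
        exacts [hLa s hs, ht, hLb s hs]
      · simpa using h
    simp [this]
  · intro h
    obtain ⟨La, Lb, rfl⟩ := List.append_of_mem h
    exact ⟨La.flatten, Lb.flatten, by simp, weight_flatten fun s hs => hL s (by simp [hs])⟩

lemma bijOn_flatten {w : A → ℤ} {t : List A} (ht : IsPrimitive w t) (n : ℕ) :
    Set.BijOn List.flatten (primitiveSeqs w t n) (avoidingWords w t n) := by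
  refine ⟨?_, ?_, ?_⟩
  · rintro L ⟨hL, hn⟩
    refine ⟨hn, weight_flatten fun s hs => (hL s hs).1, ?_⟩
    rw [exists_append_iff_mem ht fun s hs => (hL s hs).1]
    exact fun h => (hL t h).2 rfl
  · rintro L ⟨hL, -⟩ M ⟨hM, -⟩ h
    exact flatten_injOn_primitive (fun s hs => (hL s hs).1) (fun s hs => (hM s hs).1) h
  · rintro l ⟨hn, h0, hl⟩
    obtain ⟨L, hL, rfl⟩ := exists_flatten_primitive l h0
    rw [exists_append_iff_mem ht hL] at hl
    exact ⟨L, ⟨fun s hs => ⟨hL s hs, fun h => hl (h ▸ hs)⟩, hn⟩, rfl⟩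

/-- A bijection on factors that doubles lengths extends to sequences. Evenness is needed for
surjectivity, since `hf` reaches target words of even length only. -/
lemma bijOn_map_primitiveSeqs {B : Type*} {w : A → ℤ} {t : List A} {w' : B → ℤ} {t' : List B}
    {f : List A → List B}
    (hf : ∀ k, Set.BijOn f (primitiveWords w t k) (primitiveWords w' t' (2 * k))) (n : ℕ)
    (heven : ∀ s, IsPrimitive w' s → Even s.length) :
    Set.BijOn (List.map f) (primitiveSeqs w t n) (primitiveSeqs w' t' (2 * n)) := by
  have hmaps : ∀ s, IsPrimitive w s → s ≠ t →
      (IsPrimitive w' (f s) ∧ f s ≠ t') ∧ (f s).length = 2 * s.length := by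
    intro s hs hst
    have := (hf s.length).mapsTo ⟨hs, hst, rfl⟩
    exact ⟨⟨this.1, this.2.1⟩, this.2.2⟩
  have hlen : ∀ L : List (List A), (∀ s ∈ L, IsPrimitive w s ∧ s ≠ t) →
      (L.map f).flatten.length = 2 * L.flatten.length := by
    intro L hL
    induction L with
    | nil => rfl
    | cons s L ih =>
      simp only [List.mem_cons, forall_eq_or_imp] at hL
      have h1 := (hmaps s hL.1.1 hL.1.2).2
      have h2 := ih hL.2
      simp only [List.map_cons, List.flatten_cons, List.length_append]
      omega
  refine ⟨?_, ?_, ?_⟩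
  · rintro L ⟨hL, rfl⟩
    refine ⟨?_, hlen L hL⟩
    intro s hs
    obtain ⟨r, hr, rfl⟩ := List.mem_map.1 hs
    exact (hmaps r (hL r hr).1 (hL r hr).2).1
  · rintro L ⟨hL, -⟩ M ⟨hM, -⟩ h
    induction L generalizing M with
    | nil => simpa using h.symm
    | cons s L ih =>
      cases M with
      | nil => simp at h
      | cons r M =>
        simp only [List.map_cons, List.cons.injEq] at h
        simp only [List.mem_cons, forall_eq_or_imp] at hL hM
        have hs := (hmaps s hL.1.1 hL.1.2).2
        have hr := (hmaps r hM.1.1 hM.1.2).2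
        rw [h.1] at hs
        -- Injectivity is known only within one length; equal images force equal lengths because `f`
        -- doubles them.
        have hsr : s = r := (hf s.length).injOn ⟨hL.1.1, hL.1.2, rfl⟩
          ⟨hM.1.1, hM.1.2, by omega⟩ h.1
        rw [hsr, ih hL.2 hM.2 h.2]
  · rintro M ⟨hM, hn⟩
    have : ∃ L : List (List A), (∀ s ∈ L, IsPrimitive w s ∧ s ≠ t) ∧ L.map f = M := by
      clear hn
      induction M with
      | nil => exact ⟨[], by simp, rfl⟩
      | cons r M ih =>
        simp only [List.mem_cons, forall_eq_or_imp] at hM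
        obtain ⟨L, hL, rfl⟩ := ih hM.2
        obtain ⟨k, hk⟩ := heven r hM.1.1
        obtain ⟨s, hs, rfl⟩ := (hf k).surjOn ⟨hM.1.1, hM.1.2, by omega⟩
        exact ⟨s :: L, by simpa using ⟨⟨hs.1, hs.2.1⟩, hL⟩, rfl⟩
    obtain ⟨L, hL, rfl⟩ := this
    have := hlen L hL
    exact ⟨L, ⟨hL, by omega⟩, rfl⟩

/-- Generating function recursion: a nonempty sequence is a first word and a sequence. -/
lemma card_primitiveSeqs_succ {w : A → ℤ} {t : List A} [Finite A] (n : ℕ)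
    (heven : ∀ s, IsPrimitive w s → Even s.length) :
    (primitiveSeqs w t (2 * (n + 1))).ncard = ∑ ij ∈ Finset.HasAntidiagonal.antidiagonal n,
      (primitiveWords w t (2 * (ij.1 + 1))).ncard * (primitiveSeqs w t (2 * ij.2)).ncard := by
  have hfinP : ∀ k, (primitiveWords w t k).Finite := fun k =>
    (List.finite_length_eq A k).subset fun s hs => hs.2.2
  have hfinS : ∀ k, (primitiveSeqs w t k).Finite := by
    intro k
    refine Set.Finite.of_injOn (f := List.flatten) (t := {l : List A | l.length = k})
      (fun L hL => hL.2) ?_ (List.finite_length_eq A k)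
    rintro L ⟨hL, -⟩ M ⟨hM, -⟩ h
    exact flatten_injOn_primitive (fun s hs => (hL s hs).1) (fun s hs => (hM s hs).1) h
  have hset : primitiveSeqs w t (2 * (n + 1)) = ⋃ ij ∈ Finset.HasAntidiagonal.antidiagonal n,
      (fun p : List A × List (List A) => p.1 :: p.2) ''
        (primitiveWords w t (2 * (ij.1 + 1)) ×ˢ primitiveSeqs w t (2 * ij.2)) := by
    ext L
    simp only [Set.mem_iUnion, Set.mem_image, Set.mem_prod, Prod.exists, exists_prop]
    constructor
    · rintro ⟨hL, hn⟩
      cases L with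
      | nil => simp at hn
      | cons s L =>
        simp only [List.mem_cons, forall_eq_or_imp] at hL
        simp only [List.flatten_cons, List.length_append] at hn
        obtain ⟨k, hk⟩ := heven s hL.1.1
        have hpos := List.length_pos_iff.2 hL.1.1.1
        -- The first word has length `2 * k` with `k ≥ 1`, hence the shift by one in the index.
        refine ⟨k - 1, n - (k - 1), Finset.HasAntidiagonal.mem_antidiagonal.2 (by omega), s, L, ⟨⟨hL.1.1, hL.1.2, by omega⟩, hL.2, ?_⟩, rfl⟩
        omega
    · rintro ⟨i, j, hij, s, L, ⟨hs, hL⟩, rfl⟩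
      simp only [Finset.HasAntidiagonal.mem_antidiagonal] at hij
      refine ⟨by simpa using ⟨⟨hs.1, hs.2.1⟩, hL.1⟩, ?_⟩
      have := hs.2.2
      have := hL.2
      simp only [List.flatten_cons, List.length_append]
      omega
  rw [hset]
  have hbU := Set.Finite.ncard_biUnion
    (Finset.finite_toSet (Finset.HasAntidiagonal.antidiagonal n))
    (s := fun ij : ℕ × ℕ => (fun p : List A × List (List A) => p.1 :: p.2) ''
        (primitiveWords w t (2 * (ij.1 + 1)) ×ˢ primitiveSeqs w t (2 * ij.2)))
    (fun ij _ => ((hfinP _).prod (hfinS _)).image _) (by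
      rintro ⟨i, j⟩ hij ⟨i', j'⟩ hij' hne
      simp only [Finset.mem_coe, Finset.HasAntidiagonal.mem_antidiagonal] at hij hij'
      rw [Function.onFun, Set.disjoint_left]
      rintro _ ⟨⟨s, L⟩, ⟨hs, hL⟩, rfl⟩ ⟨⟨s', L'⟩, ⟨hs', hL'⟩, h⟩
      simp only [List.cons.injEq] at h hs hs'
      obtain ⟨rfl, rfl⟩ := h
      have h1 := hs.2.2
      have h2 := hs'.2.2
      apply hne
      simp only [Prod.mk.injEq]
      omega)
  simp only [Finset.mem_coe] at hbU
  rw [hbU, finsum_mem_finset_eq_sum]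
  refine Finset.sum_congr rfl fun ij _ => ?_
  rw [Set.ncard_image_of_injective, Set.ncard_prod]
  rintro ⟨s, L⟩ ⟨s', L'⟩ h
  simpa using h

end Factorization

/-! ### Pairs of compositions as words of pairs of steps -/

/-- The lattice path of a list of parts. -/
def blocksPath (b : List ℕ) : List NEStep :=
  b.flatMap fun a => List.replicate (a - 1) NEStep.N ++ [NEStep.E]

@[simp] lemma blocksPath_nil : blocksPath [] = [] := rfl

@[simp] lemma blocksPath_cons (a : ℕ) (b : List ℕ) :
    blocksPath (a :: b) = List.replicate (a - 1) NEStep.N ++ NEStep.E :: blocksPath b := by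
  simp [blocksPath]

@[simp] lemma blocksPath_append (b c : List ℕ) :
    blocksPath (b ++ c) = blocksPath b ++ blocksPath c := by
  simp [blocksPath]

lemma length_blocksPath {b : List ℕ} (hb : ∀ a ∈ b, 0 < a) : (blocksPath b).length = b.sum := by
  induction b with
  | nil => rfl
  | cons a b ih =>
    simp only [List.mem_cons, forall_eq_or_imp] at hb
    simp only [blocksPath_cons, List.length_append, List.length_replicate, List.length_cons,
      ih hb.2, List.sum_cons]
    omega

lemma count_E_blocksPath (b : List ℕ) : (blocksPath b).count NEStep.E = b.length := by
  induction b with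
  | nil => rfl
  | cons a b ih => simp [ih, List.count_replicate]

lemma replicate_append_cons_inj {m n : ℕ} {l l' : List NEStep}
    (h : List.replicate m NEStep.N ++ NEStep.E :: l = List.replicate n NEStep.N ++ NEStep.E :: l') :
    m = n ∧ l = l' := by
  induction m generalizing n with
  | zero => cases n <;> simp_all [List.replicate_succ]
  | succ m ih =>
    cases n with
    | zero => simp [List.replicate_succ] at h
    | succ n =>
      simp only [List.replicate_succ, List.cons_append, List.cons.injEq, true_and] at h
      simpa using ih h

lemma blocksPath_inj : ∀ {b c : List ℕ}, (∀ a ∈ b, 0 < a) → (∀ a ∈ c, 0 < a) →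
    blocksPath b = blocksPath c → b = c
  | [], [], _, _, _ => rfl
  | [], _ :: _, _, _, h => by simp at h
  | _ :: _, [], _, _, h => by simp at h
  | x :: b, y :: c, hb, hc, h => by
    simp only [List.mem_cons, forall_eq_or_imp] at hb hc
    simp only [blocksPath_cons] at h
    obtain ⟨h1, h2⟩ := replicate_append_cons_inj h
    rw [blocksPath_inj hb.2 hc.2 h2, show x = y by omega]

/-- Built from the front: a leading East step is a new part 1, and a leading North step enlarges the
first part. The final East step guarantees that such a part exists. -/
lemma exists_blocksPath_eq (l : List NEStep) :
    ∃ b : List ℕ, (∀ a ∈ b, 0 < a) ∧ blocksPath b = l ++ [NEStep.E] := by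
  induction l with
  | nil => exact ⟨[1], by simp, by simp⟩
  | cons s l ih =>
    obtain ⟨b, hb, h⟩ := ih
    cases s with
    | E => exact ⟨1 :: b, by simpa using hb, by simp [h]⟩
    | N =>
      cases b with
      | nil => simp at h
      | cons a b =>
        simp only [List.mem_cons, forall_eq_or_imp] at hb
        refine ⟨(a + 1) :: b, by simpa using hb.2, ?_⟩
        obtain ⟨a, rfl⟩ := Nat.exists_eq_succ_of_ne_zero hb.1.ne'
        simp only [blocksPath_cons, Nat.succ_eq_add_one, Nat.add_sub_cancel] at h ⊢
        simp [List.replicate_succ, h]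

lemma compositionPath_eq {n : ℕ} (c : Composition n) :
    compositionPath c = blocksPath c.blocks := rfl

lemma length_compositionPath {n : ℕ} (c : Composition n) : (compositionPath c).length = n := by
  rw [compositionPath_eq, length_blocksPath fun a h => c.blocks_pos h, c.blocks_sum]

lemma blocksPath_dropLast_append {b : List ℕ} (hb : b ≠ []) :
    (blocksPath b).dropLast ++ [NEStep.E] = blocksPath b := by
  obtain ⟨c, a, rfl⟩ : ∃ c a, b = c ++ [a] := ⟨_, _, (List.dropLast_append_getLast hb).symm⟩
  simp [← List.append_assoc]

lemma dropLast_compositionPath_append {n : ℕ} (c : Composition (n + 1)) :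
    (compositionPath c).dropLast ++ [NEStep.E] = compositionPath c :=
  blocksPath_dropLast_append (by simp)

lemma length_dropLast_compositionPath {n : ℕ} (c : Composition (n + 1)) :
    (compositionPath c).dropLast.length = n := by
  simp [length_compositionPath]

lemma dropLast_compositionPath_injective {n : ℕ} :
    Function.Injective fun c : Composition (n + 1) => (compositionPath c).dropLast := by
  intro c d h
  apply Composition.ext
  apply blocksPath_inj (fun a h => c.blocks_pos h) (fun a h => d.blocks_pos h)
  rw [← compositionPath_eq, ← compositionPath_eq, ← dropLast_compositionPath_append c,
    ← dropLast_compositionPath_append d]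
  exact congrArg (· ++ [NEStep.E]) h

lemma exists_dropLast_compositionPath_eq {n : ℕ} {l : List NEStep} (hl : l.length = n) :
    ∃ c : Composition (n + 1), (compositionPath c).dropLast = l := by
  obtain ⟨b, hb, h⟩ := exists_blocksPath_eq l
  refine ⟨⟨b, fun h => hb _ h, ?_⟩, ?_⟩
  · rw [← length_blocksPath hb, h]
    simp [hl]
  · rw [compositionPath_eq]
    simp [h]

/-- Prefixes of the path of a composition that end in an East step come from partial sums. -/
lemma take_blocks_of_dropLast_eq {n : ℕ} {c : Composition (n + 1)} {u v : List NEStep}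
    (h : (compositionPath c).dropLast = u ++ NEStep.E :: v) :
    u.count NEStep.E + 1 < c.length ∧ c.sizeUpTo (u.count NEStep.E + 1) = u.length + 1 := by
  obtain ⟨b, hb, hbu⟩ := exists_blocksPath_eq u
  obtain ⟨d, hd, hdv⟩ := exists_blocksPath_eq v
  have hc : c.blocks = b ++ d := by
    apply blocksPath_inj (fun a h => c.blocks_pos h)
    · simpa only [List.mem_append, or_imp, forall_and] using ⟨hb, hd⟩
    · rw [← compositionPath_eq, ← dropLast_compositionPath_append c, h, blocksPath_append, hbu, hdv]
      simp
  have hlen : u.count NEStep.E + 1 = b.length := by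
    rw [← count_E_blocksPath, hbu]
    simp
  have hd0 : 0 < d.length := by
    rw [List.length_pos_iff]
    rintro rfl
    simp at hdv
  rw [hlen, Composition.sizeUpTo, Composition.length, hc, ← length_blocksPath]
  · simp [hbu, hd0]
  · simpa using hb

lemma exists_dropLast_compositionPath_eq_append {n : ℕ} (c : Composition (n + 1)) {j : ℕ}
    (h0 : 0 < j) (hj : j < c.length) :
    ∃ u v, (compositionPath c).dropLast = u ++ NEStep.E :: v ∧ u.count NEStep.E + 1 = j ∧
      u.length + 1 = c.sizeUpTo j := by
  have htake : c.blocks.take j ≠ [] := by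
    simp [h0.ne']
  have hdrop : c.blocks.drop j ≠ [] := by
    simpa using hj
  have h1 := blocksPath_dropLast_append htake
  have h2 := blocksPath_dropLast_append hdrop
  refine ⟨(blocksPath (c.blocks.take j)).dropLast, (blocksPath (c.blocks.drop j)).dropLast,
    ?_, ?_, ?_⟩
  -- As `0 < j < c.length`, both groups of parts are nonempty, so each of their paths ends in an
  -- East step. The one closing part `j` is thus not the one that truncation removes.
  · apply List.append_cancel_right (bs := [NEStep.E])
    rw [dropLast_compositionPath_append, compositionPath_eq]
    conv_lhs => rw [← List.take_append_drop j c.blocks, blocksPath_append, ← h1, ← h2]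
    simp
  · have := congrArg (List.count NEStep.E) h1
    rw [count_E_blocksPath] at this
    simp only [List.count_append, List.length_take] at this
    simp only [List.count_singleton_self] at this
    rw [this]
    exact min_eq_left hj.le
  · have := congrArg List.length h1
    rw [length_blocksPath fun a h => c.blocks_pos (List.mem_of_mem_take h)] at this
    simpa [Composition.sizeUpTo] using this

/-- The change of the height difference of two paths in a pair of steps. -/
def pairWeight : NEStep × NEStep → ℤ
  | (.N, .E) => 1
  | (.E, .N) => -1
  | _ => 0

lemma weight_pairWeight (l : List (NEStep × NEStep)) :
    weight pairWeight l =
      ((l.map Prod.fst).count NEStep.N : ℤ) - (l.map Prod.snd).count NEStep.N := by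
  induction l with
  | nil => simp
  | cons s l ih =>
    obtain ⟨_ | _, _ | _⟩ := s <;> simp [ih, pairWeight] <;> ring

lemma count_N_add_count_E (l : List NEStep) : l.count NEStep.N + l.count NEStep.E = l.length := by
  induction l with
  | nil => rfl
  | cons s l ih => cases s <;> simp <;> omega

lemma isPrimitive_pair_EE : IsPrimitive pairWeight [(NEStep.E, NEStep.E)] := by
  refine ⟨by simp, rfl, ?_⟩
  intro a b h ha hb
  have := congrArg List.length h
  have := List.length_pos_iff.2 ha
  have := List.length_pos_iff.2 hb
  simp at *
  omega

/-- The truncated lattice paths of a pair of compositions, as one word. -/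
def pairWord {n : ℕ} (c : Composition n × Composition n) : List (NEStep × NEStep) :=
  (compositionPath c.1).dropLast.zip (compositionPath c.2).dropLast

lemma map_fst_pairWord {n : ℕ} (c : Composition (n + 1) × Composition (n + 1)) :
    (pairWord c).map Prod.fst = (compositionPath c.1).dropLast :=
  List.map_fst_zip (by simp only [length_dropLast_compositionPath, le_refl])

lemma map_snd_pairWord {n : ℕ} (c : Composition (n + 1) × Composition (n + 1)) :
    (pairWord c).map Prod.snd = (compositionPath c.2).dropLast :=
  List.map_snd_zip (by simp only [length_dropLast_compositionPath, le_refl])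

lemma length_pairWord {n : ℕ} (c : Composition (n + 1) × Composition (n + 1)) :
    (pairWord c).length = n := by
  simp only [pairWord, List.length_zip, length_dropLast_compositionPath, min_self]

lemma count_E_dropLast {n : ℕ} (c : Composition (n + 1)) :
    (compositionPath c).dropLast.count NEStep.E + 1 = c.length := by
  rw [Composition.length, ← count_E_blocksPath, ← compositionPath_eq,
    ← dropLast_compositionPath_append c]
  simp

lemma weight_pairWord_eq_zero_iff {n : ℕ} (c : Composition (n + 1) × Composition (n + 1)) :
    weight pairWeight (pairWord c) = 0 ↔ c.1.length = c.2.length := by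
  rw [weight_pairWeight, map_fst_pairWord, map_snd_pairWord, ← count_E_dropLast,
    ← count_E_dropLast]
  have h1 := count_N_add_count_E (compositionPath c.1).dropLast
  have h2 := count_N_add_count_E (compositionPath c.2).dropLast
  rw [length_dropLast_compositionPath] at h1 h2
  omega

/-- The `j`-th partial sum is the position of the `j`-th East step. Two such steps coincide exactly
when they form a letter `(E, E)` after prefixes of equal length with `j - 1` East steps each, that
is, at weight zero. -/
lemma exists_common_sizeUpTo_iff {n : ℕ} (c : Composition (n + 1) × Composition (n + 1))
    (hc : c.1.length = c.2.length) :
    (∃ j, 0 < j ∧ j < c.1.length ∧ c.1.sizeUpTo j = c.2.sizeUpTo j) ↔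
      ∃ a b, pairWord c = a ++ [(NEStep.E, NEStep.E)] ++ b ∧ weight pairWeight a = 0 := by
  constructor
  · rintro ⟨j, h0, hj, h⟩
    obtain ⟨u, v, huv, hu, hul⟩ := exists_dropLast_compositionPath_eq_append c.1 h0 hj
    obtain ⟨u', v', huv', hu', hul'⟩ :=
      exists_dropLast_compositionPath_eq_append c.2 h0 (hc ▸ hj)
    have hl : u.length = u'.length := by omega
    refine ⟨u.zip u', v.zip v', ?_, ?_⟩
    · rw [pairWord, huv, huv', List.zip_append hl]
      simp
    · rw [weight_pairWeight, List.map_fst_zip hl.le, List.map_snd_zip hl.ge]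
      have h1 := count_N_add_count_E u
      have h2 := count_N_add_count_E u'
      omega
  · rintro ⟨a, b, h, ha⟩
    have h1 := map_fst_pairWord c
    have h2 := map_snd_pairWord c
    rw [h] at h1 h2
    simp only [List.map_append, List.append_assoc, List.map_cons,
      List.singleton_append] at h1 h2
    obtain ⟨hlt, h3⟩ := take_blocks_of_dropLast_eq h1.symm
    obtain ⟨-, h4⟩ := take_blocks_of_dropLast_eq h2.symm
    rw [weight_pairWeight] at ha
    have h5 := count_N_add_count_E (a.map Prod.fst)
    have h6 := count_N_add_count_E (a.map Prod.snd)
    simp only [List.length_map] at h3 h4 h5 h6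
    have h7 : (a.map Prod.fst).count NEStep.E = (a.map Prod.snd).count NEStep.E := by omega
    exact ⟨_, by omega, hlt, by rw [h3, h7, h4]⟩

lemma bijOn_pairWord (n : ℕ) :
    Set.BijOn pairWord (irreduciblePairs (n + 1))
      (avoidingWords pairWeight [(NEStep.E, NEStep.E)] n) := by
  have hiff : ∀ c : Composition (n + 1) × Composition (n + 1), c ∈ irreduciblePairs (n + 1) ↔
      pairWord c ∈ avoidingWords pairWeight [(NEStep.E, NEStep.E)] n := by
    intro c
    by_cases hc : c.1.length = c.2.length
    · have := exists_common_sizeUpTo_iff c hc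
      simp only [avoidingWords, irreduciblePairs, Set.mem_ofPred_eq, ← this, length_pairWord,
        weight_pairWord_eq_zero_iff, hc, true_and]
      push Not
      rfl
    · simp [avoidingWords, irreduciblePairs, weight_pairWord_eq_zero_iff, hc]
  refine ⟨fun c hc => (hiff c).1 hc, ?_, ?_⟩
  · intro c _ d _ h
    apply Prod.ext <;> apply dropLast_compositionPath_injective <;> dsimp only
    · rw [← map_fst_pairWord, h, map_fst_pairWord]
    · rw [← map_snd_pairWord, h, map_snd_pairWord]
  · intro l hl
    obtain ⟨c, hc⟩ := exists_dropLast_compositionPath_eq (l := l.map Prod.fst) (by simpa using hl.1)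
    obtain ⟨d, hd⟩ := exists_dropLast_compositionPath_eq (l := l.map Prod.snd) (by simpa using hl.1)
    have h : pairWord (c, d) = l := by
      rw [pairWord, hc, hd]
      exact (List.zip_of_prod rfl rfl).symm
    exact ⟨(c, d), (hiff _).2 (h ▸ hl), h⟩

/-! ### Splitting at the common vertices -/

/-- The test in `splitAux` asks for weight zero; inside a primitive word `acc ++ r` it first
succeeds at the end of `r`. -/
lemma splitAux_append {acc r l : List (NEStep × NEStep)} (hr : r ≠ [])
    (h : IsPrimitive pairWeight (acc ++ r)) :
    splitAux acc (r ++ l) = (acc ++ r).unzip :: splitAux [] l := by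
  induction r generalizing acc with
  | nil => exact absurd rfl hr
  | cons s r ih =>
    rw [List.cons_append, splitAux]
    by_cases hr' : r = []
    · subst hr'
      have := h.2.1
      rw [weight_pairWeight] at this
      rw [if_pos (by omega), List.nil_append]
    · have h0 := h.2.2 (acc ++ [s]) r (by simp) (by simp) hr'
      rw [weight_pairWeight] at h0
      rw [if_neg (by omega), ih hr' (by simpa using h)]
      simp

lemma splitAux_flatten {L : List (List (NEStep × NEStep))}
    (hL : ∀ s ∈ L, IsPrimitive pairWeight s) :
    splitAux [] L.flatten = L.map List.unzip := by
  induction L with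
  | nil => simp [splitAux]
  | cons s L ih =>
    simp only [List.mem_cons, forall_eq_or_imp] at hL
    rw [List.flatten_cons, splitAux_append hL.1.1 (by simpa using hL.1), ih hL.2]
    simp

/-! ### Positive words -/

section Positive

variable {A : Type*}

/-- A word of weight zero whose proper nonempty prefixes have positive weight. -/
def IsPositive (w : A → ℤ) (l : List A) : Prop :=
  weight w l = 0 ∧ ∀ i, 0 < i → i < l.length → 0 < weight w (l.take i)

@[simp] lemma weight_neg (w : A → ℤ) (l : List A) : weight (-w) l = -weight w l := by
  induction l with
  | nil => simp
  | cons a l ih => simp [ih]; ring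

lemma isPrimitive_iff_take {w : A → ℤ} {l : List A} :
    IsPrimitive w l ↔ l ≠ [] ∧ weight w l = 0 ∧
      ∀ i, 0 < i → i < l.length → weight w (l.take i) ≠ 0 := by
  refine and_congr_right fun hl => and_congr_right fun h0 => ⟨fun h i hi hil => ?_, ?_⟩
  · exact h _ _ (List.take_append_drop i l).symm (by simp [hl, hi.ne']) (by simpa using hil)
  · rintro h a b rfl ha hb
    have := h a.length (List.length_pos_iff.2 ha) (by simpa using List.length_pos_iff.2 hb)
    simpa using this

lemma isPrimitive_neg {w : A → ℤ} {l : List A} : IsPrimitive (-w) l ↔ IsPrimitive w l := by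
  simp [isPrimitive_iff_take]

lemma IsPositive.isPrimitive {w : A → ℤ} {l : List A} (h : IsPositive w l) (hl : l ≠ []) :
    IsPrimitive w l :=
  isPrimitive_iff_take.2 ⟨hl, h.1, fun i hi hil => (h.2 i hi hil).ne'⟩

lemma weight_take_succ (w : A → ℤ) {l : List A} {i : ℕ} (hi : i < l.length) :
    weight w (l.take (i + 1)) = weight w (l.take i) + w l[i] := by
  rw [List.take_succ_eq_append_getElem hi, weight_append, weight_cons, weight_nil, add_zero]

/-- Discrete intermediate value argument: steps of size at most 1 cannot pass from positive to
negative without visiting zero. -/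
lemma isPositive_of_pos {w : A → ℤ} (hw : ∀ a, |w a| ≤ 1) {l : List A} (h : IsPrimitive w l)
    (h1 : 0 < weight w (l.take 1)) : IsPositive w l := by
  refine ⟨h.2.1, fun i hi => ?_⟩
  induction i, hi using Nat.le_induction with
  | base => exact fun _ => h1
  | succ i hi ih =>
    intro hil
    have h2 := ih (by omega)
    have h3 := (isPrimitive_iff_take.1 h).2.2 (i + 1) (by omega) hil
    rw [weight_take_succ w (by omega)] at h3 ⊢
    have := abs_le.1 (hw l[i])
    omega

/-- A primitive word stays on one side of level zero. -/
lemma IsPrimitive.isPositive_or {w : A → ℤ} (hw : ∀ a, |w a| ≤ 1) {l : List A}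
    (h : IsPrimitive w l) : IsPositive w l ∨ IsPositive (-w) l := by
  by_cases hl : 1 < l.length
  · rcases lt_or_gt_of_ne ((isPrimitive_iff_take.1 h).2.2 1 one_pos hl) with h1 | h1
    · exact .inr (isPositive_of_pos (by simpa using hw) (isPrimitive_neg.2 h) (by simpa using h1))
    · exact .inl (isPositive_of_pos hw h h1)
  · exact .inl ⟨h.2.1, fun i hi hil => by omega⟩

/-- The length bound matters: a single letter of weight zero has no proper nonempty prefix and is
vacuously positive for both signs. -/
lemma IsPositive.not_neg {w : A → ℤ} {l : List A} (h : IsPositive w l) (hl : 2 ≤ l.length) :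
    ¬ IsPositive (-w) l := by
  intro h'
  have h1 := h.2 1 one_pos hl
  have h2 := h'.2 1 one_pos hl
  simp only [weight_neg] at h2
  omega

end Positive

/-! ### Primitive Dyck paths -/

/-- The change of height in a step. -/
def stepWeight : DyckStep → ℤ
  | .U => 1
  | .D => -1

lemma abs_stepWeight_le (a : DyckStep) : |stepWeight a| ≤ 1 := by cases a <;> decide

lemma weight_stepWeight (l : List DyckStep) :
    weight stepWeight l = (l.count DyckStep.U : ℤ) - l.count DyckStep.D := by
  induction l with
  | nil => simp
  | cons s l ih => cases s <;> simp [ih, stepWeight] <;> ring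

lemma count_U_add_count_D (l : List DyckStep) :
    l.count DyckStep.U + l.count DyckStep.D = l.length := by
  induction l with
  | nil => rfl
  | cons s l ih => cases s <;> simp <;> omega

lemma even_length_of_isPrimitive (l : List DyckStep) (h : IsPrimitive stepWeight l) :
    Even l.length := by
  have h1 := h.2.1
  have h2 := count_U_add_count_D l
  rw [weight_stepWeight] at h1
  exact ⟨l.count DyckStep.U, by omega⟩

@[simp] lemma flipPath_flipPath (l : List DyckStep) : flipPath (flipPath l) = l := by
  rw [flipPath, flipPath, List.map_map]
  convert List.map_id l
  ext s
  cases s <;> rfl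

lemma flipPath_injective : Function.Injective flipPath :=
  Function.LeftInverse.injective flipPath_flipPath

@[simp] lemma length_flipPath (l : List DyckStep) : (flipPath l).length = l.length := by
  simp [flipPath]

@[simp] lemma flipPath_eq_nil {l : List DyckStep} : flipPath l = [] ↔ l = [] := by
  simp [flipPath]

lemma weight_flipPath (l : List DyckStep) :
    weight stepWeight (flipPath l) = -weight stepWeight l := by
  induction l with
  | nil => simp [flipPath]
  | cons s l ih =>
    rw [flipPath] at ih
    cases s <;> simp [flipPath, flipStep, stepWeight, ih] <;> ring

lemma take_flipPath (l : List DyckStep) (i : ℕ) : (flipPath l).take i = flipPath (l.take i) := by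
  simp [flipPath]

lemma isPrimitive_flipPath {l : List DyckStep} :
    IsPrimitive stepWeight (flipPath l) ↔ IsPrimitive stepWeight l := by
  simp [isPrimitive_iff_take, take_flipPath, weight_flipPath]

lemma isPositive_flipPath {l : List DyckStep} :
    IsPositive stepWeight (flipPath l) ↔ IsPositive (-stepWeight) l := by
  simp [IsPositive, take_flipPath, weight_flipPath]

lemma isPositive_nest (w : DyckWord) : IsPositive stepWeight w.nest.toList := by
  constructor
  · rw [weight_stepWeight, w.nest.count_U_eq_count_D, sub_self]
  · intro i hi hil
    have := DyckWord.IsNested.nest (p := w) |>.2 hi hil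
    rw [weight_stepWeight]
    omega

lemma isPrimitive_nest (w : DyckWord) : IsPrimitive stepWeight w.nest.toList :=
  (isPositive_nest w).isPrimitive (DyckWord.toList_ne_nil.2 DyckWord.nest_ne_zero)

lemma length_nest (w : DyckWord) : w.nest.toList.length = 2 * (w.semilength + 1) := by
  rw [← DyckWord.two_mul_semilength_eq_length, DyckWord.semilength_nest]

lemma nest_injective : Function.Injective fun w : DyckWord => w.nest.toList := by
  intro v w h
  have h' : v.nest = w.nest := DyckWord.ext h
  have := congrArg DyckWord.insidePart h'
  simpa using this

/-- Positivity is exactly nestedness of a Dyck word, so the outer `U` and `D` can be stripped. -/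
lemma IsPositive.exists_nest {l : List DyckStep} (h : IsPositive stepWeight l) (hl : l ≠ []) :
    ∃ w : DyckWord, w.nest.toList = l := by
  let p : DyckWord := ⟨l, by have := h.1; rw [weight_stepWeight] at this; omega, by
    intro i
    rcases Nat.eq_zero_or_pos i with rfl | hi
    · simp
    · by_cases hil : i < l.length
      · have := h.2 i hi hil
        rw [weight_stepWeight] at this
        omega
      · have := h.1
        rw [weight_stepWeight] at this
        rw [List.take_of_length_le (by omega)]
        omega⟩
  have hp : p.IsNested := ⟨DyckWord.toList_ne_nil.1 hl, fun i hi hil => by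
    have := h.2 i hi hil
    rw [weight_stepWeight] at this
    change (l.take i).count _ < (l.take i).count _
    omega⟩
  exact ⟨p.denest hp, by rw [DyckWord.nest_denest]⟩

lemma IsPrimitive.exists_nest_or {l : List DyckStep} (h : IsPrimitive stepWeight l) :
    ∃ w : DyckWord, w.nest.toList = l ∨ flipPath w.nest.toList = l := by
  rcases h.isPositive_or abs_stepWeight_le with h' | h'
  · obtain ⟨w, hw⟩ := h'.exists_nest h.1
    exact ⟨w, .inl hw⟩
  · obtain ⟨w, hw⟩ := (isPositive_flipPath.2 h').exists_nest (by simpa [flipPath] using h.1)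
    exact ⟨w, .inr (by rw [hw, flipPath_flipPath])⟩

lemma nest_ne_flipPath_nest (v w : DyckWord) : v.nest.toList ≠ flipPath w.nest.toList := by
  intro h
  simp [DyckWord.nest, flipPath, flipStep] at h

lemma isPrimitive_UD : IsPrimitive stepWeight [DyckStep.U, DyckStep.D] := isPrimitive_nest 0

lemma lowPeakFreePaths_eq (n : ℕ) :
    lowPeakFreePaths n = avoidingWords stepWeight [DyckStep.U, DyckStep.D] (2 * n) := by
  ext p
  have h1 := count_U_add_count_D p
  simp only [lowPeakFreePaths, avoidingWords, IsGrandDyck, HasLowPeak, Set.mem_ofPred_eq,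
    weight_stepWeight, ← and_assoc, sub_eq_zero, Nat.cast_inj]
  refine and_congr_left fun _ => ?_
  omega

/-! ### Polyominoes as primitive words -/

lemma abs_pairWeight_le (a : NEStep × NEStep) : |pairWeight a| ≤ 1 := by
  obtain ⟨_ | _, _ | _⟩ := a <;> decide

lemma isParallelogram_iff {s : List (NEStep × NEStep)} :
    IsParallelogram (s.map Prod.fst) (s.map Prod.snd) ↔
      2 ≤ s.length ∧ IsPositive pairWeight s := by
  simp only [IsParallelogram, IsPositive, weight_pairWeight, List.length_map, true_and,
    ← List.map_take, sub_eq_zero, Nat.cast_inj, sub_pos, Nat.cast_lt]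
  exact and_congr_right fun _ => and_congr_right fun _ => forall_congr' fun _ => forall_comm

lemma isParallelogram_swap_iff {s : List (NEStep × NEStep)} :
    IsParallelogram (s.map Prod.snd) (s.map Prod.fst) ↔
      2 ≤ s.length ∧ IsPositive (-pairWeight) s := by
  simp only [IsParallelogram, IsPositive, weight_pairWeight, List.length_map, true_and, weight_neg,
    ← List.map_take, neg_sub, sub_eq_zero, Nat.cast_inj, sub_pos, Nat.cast_lt]
  exact and_congr_right fun _ => and_congr_right fun _ => forall_congr' fun _ => forall_comm

/-- The piece of a pair of paths that encloses a polyomino, with given colour of the upper path. -/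
def polyominoPiece (P : ParallelogramPolyomino) : Colour → List (NEStep × NEStep)
  | .blue => P.upper.zip P.lower
  | .red => P.lower.zip P.upper

lemma unzip_polyominoPiece_blue (P : ParallelogramPolyomino) :
    (polyominoPiece P .blue).unzip = (P.upper, P.lower) :=
  List.unzip_zip P.isParallelogram.1

lemma unzip_polyominoPiece_red (P : ParallelogramPolyomino) :
    (polyominoPiece P .red).unzip = (P.lower, P.upper) :=
  List.unzip_zip P.isParallelogram.1.symm

lemma isPositive_polyominoPiece_blue (P : ParallelogramPolyomino) :
    2 ≤ (polyominoPiece P .blue).length ∧ IsPositive pairWeight (polyominoPiece P .blue) := by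
  have h := unzip_polyominoPiece_blue P
  rw [List.unzip_eq_map, Prod.mk.injEq] at h
  rw [← isParallelogram_iff, h.1, h.2]
  exact P.isParallelogram

lemma isPositive_polyominoPiece_red (P : ParallelogramPolyomino) :
    2 ≤ (polyominoPiece P .red).length ∧ IsPositive (-pairWeight) (polyominoPiece P .red) := by
  have h := unzip_polyominoPiece_red P
  rw [List.unzip_eq_map, Prod.mk.injEq] at h
  rw [← isParallelogram_swap_iff, h.1, h.2]
  exact P.isParallelogram

lemma length_polyominoPiece (P : ParallelogramPolyomino) (c : Colour) :
    (polyominoPiece P c).length = P.semiperimeter := by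
  have := P.isParallelogram.1
  cases c <;> simp [polyominoPiece, ParallelogramPolyomino.semiperimeter, this]

lemma isPrimitive_polyominoPiece (P : ParallelogramPolyomino) (c : Colour) :
    IsPrimitive pairWeight (polyominoPiece P c) := by
  cases c
  · have h := isPositive_polyominoPiece_blue P
    exact h.2.isPrimitive (List.ne_nil_of_length_pos (by omega))
  · have h := isPositive_polyominoPiece_red P
    exact isPrimitive_neg.1 (h.2.isPrimitive (List.ne_nil_of_length_pos (by omega)))

/-- `pieceComponent` tests for blue above red first; for a red upper path that test must fail, since
no word of length at least 2 is positive for both signs. -/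
lemma pieceComponent_polyominoPiece (δ : ParallelogramPolyomino → DyckWord) (keep c : Colour)
    (P : ParallelogramPolyomino) :
    pieceComponent δ keep (polyominoPiece P c).unzip = polyominoComponent δ keep c P := by
  cases c
  · rw [unzip_polyominoPiece_blue, pieceComponent, dif_pos P.isParallelogram]
  · have h : ¬ IsParallelogram P.lower P.upper := by
      have h := isPositive_polyominoPiece_red P
      have h' := unzip_polyominoPiece_red P
      rw [List.unzip_eq_map, Prod.mk.injEq] at h'
      rw [← h'.1, ← h'.2, isParallelogram_iff]
      exact fun h2 => h2.2.not_neg h.1 h.2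
    rw [unzip_polyominoPiece_red, pieceComponent, dif_neg h, dif_pos P.isParallelogram]

lemma IsPrimitive.exists_polyominoPiece {s : List (NEStep × NEStep)}
    (h : IsPrimitive pairWeight s) (hs : 2 ≤ s.length) :
    ∃ P c, polyominoPiece P c = s := by
  rcases h.isPositive_or abs_pairWeight_le with h | h
  · exact ⟨⟨_, _, isParallelogram_iff.2 ⟨hs, h⟩⟩, .blue, (List.zip_of_prod rfl rfl).symm⟩
  · exact ⟨⟨_, _, isParallelogram_swap_iff.2 ⟨hs, h⟩⟩, .red, (List.zip_of_prod rfl rfl).symm⟩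

lemma isPrimitive_polyominoComponent (δ : ParallelogramPolyomino → DyckWord) (keep c : Colour)
    (P : ParallelogramPolyomino) : IsPrimitive stepWeight (polyominoComponent δ keep c P) := by
  unfold polyominoComponent
  split_ifs
  · exact isPrimitive_nest _
  · exact isPrimitive_flipPath.2 (isPrimitive_nest _)

lemma length_polyominoComponent {δ : ParallelogramPolyomino → DyckWord}
    (hδ : IsPolyominoBijection δ) (keep c : Colour) (P : ParallelogramPolyomino) :
    (polyominoComponent δ keep c P).length = 2 * P.semiperimeter := by
  have h2 : 2 ≤ P.semiperimeter := P.isParallelogram.2.1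
  have : (δ P).semilength = P.semiperimeter - 1 := (hδ _ h2).mapsTo rfl
  unfold polyominoComponent
  split_ifs <;> simp only [length_flipPath, length_nest] <;> omega

/-- The first step of the component reveals whether it was reflected, hence the colour; its length
gives the semiperimeter, within which `δ` is injective. -/
lemma polyominoComponent_inj {δ : ParallelogramPolyomino → DyckWord}
    (hδ : IsPolyominoBijection δ) {keep c c' : Colour} {P P' : ParallelogramPolyomino}
    (h : polyominoComponent δ keep c P = polyominoComponent δ keep c' P') : P = P' ∧ c = c' := by
  have hlen := congrArg List.length h
  rw [length_polyominoComponent hδ, length_polyominoComponent hδ] at hlen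
  have hδ' : δ P = δ P' → P = P' :=
    (hδ P.semiperimeter P.isParallelogram.2.1).injOn rfl
      (show P'.semiperimeter = _ by omega)
  unfold polyominoComponent at h
  split_ifs at h with h1 h2 h2
  · exact ⟨hδ' (nest_injective h), h1.trans h2.symm⟩
  · exact absurd h (nest_ne_flipPath_nest _ _)
  · exact absurd h.symm (nest_ne_flipPath_nest _ _)
  · refine ⟨hδ' (nest_injective (flipPath_injective h)), ?_⟩
    -- There are only two colours, so two colours different from `keep` are equal.
    cases c <;> cases c' <;> cases keep <;> simp_all

lemma exists_polyominoComponent_eq {δ : ParallelogramPolyomino → DyckWord}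
    (hδ : IsPolyominoBijection δ) (keep : Colour) {l : List DyckStep}
    (h : IsPrimitive stepWeight l) {k : ℕ} (hk : 2 ≤ k) (hl : l.length = 2 * k) :
    ∃ P c, P.semiperimeter = k ∧ polyominoComponent δ keep c P = l := by
  obtain ⟨w, hw⟩ := h.exists_nest_or
  have hlen : w.semilength = k - 1 := by
    have := length_nest w
    rcases hw with rfl | rfl
    · omega
    · rw [length_flipPath] at hl
      omega
  obtain ⟨P, hP, rfl⟩ := (hδ k hk).surjOn hlen
  rcases hw with rfl | rfl
  · exact ⟨P, keep, hP, by simp [polyominoComponent]⟩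
  · obtain ⟨c, hc⟩ : ∃ c : Colour, c ≠ keep := by
      cases keep
      exacts [⟨.red, by simp⟩, ⟨.blue, by simp⟩]
    exact ⟨P, c, hP, by simp [polyominoComponent, hc]⟩

lemma primitiveWords_pair_one :
    primitiveWords pairWeight [(NEStep.E, NEStep.E)] 1 = {[(NEStep.N, NEStep.N)]} := by
  ext s
  simp only [Set.mem_singleton_iff]
  constructor
  · rintro ⟨h, hne, hlen⟩
    obtain ⟨⟨a, b⟩, rfl⟩ := List.length_eq_one_iff.1 hlen
    have h0 := h.2.1
    cases a <;> cases b <;> simp_all [pairWeight]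
  · rintro rfl
    exact ⟨isPrimitive_iff_take.2 ⟨by simp, rfl, by simp; omega⟩, by simp, rfl⟩

lemma primitiveWords_step_two :
    primitiveWords stepWeight [DyckStep.U, DyckStep.D] 2 = {[DyckStep.D, DyckStep.U]} := by
  ext s
  simp only [Set.mem_singleton_iff]
  constructor
  · rintro ⟨h, hne, hlen⟩
    obtain ⟨a, b, rfl⟩ := List.length_eq_two.1 hlen
    have h0 := h.2.1
    cases a <;> cases b <;> simp_all [stepWeight]
  · rintro rfl
    exact ⟨isPrimitive_flipPath.1 isPrimitive_UD, by simp, rfl⟩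

/-- This is the correspondence between factors. The excluded words `(E, E)` and `UD` only affect `k
= 1`, where the degenerate piece `(N, N)` goes to `DU`. -/
lemma bijOn_pieceComponent {δ : ParallelogramPolyomino → DyckWord}
    (hδ : IsPolyominoBijection δ) (keep : Colour) (k : ℕ) :
    Set.BijOn (fun s => pieceComponent δ keep s.unzip)
      (primitiveWords pairWeight [(NEStep.E, NEStep.E)] k)
      (primitiveWords stepWeight [DyckStep.U, DyckStep.D] (2 * k)) := by
  obtain rfl | rfl | hk : k = 0 ∨ k = 1 ∨ 2 ≤ k := by omega
  · have h1 : primitiveWords pairWeight [(NEStep.E, NEStep.E)] 0 = ∅ :=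
      Set.eq_empty_of_forall_notMem fun s hs => hs.1.1 (List.length_eq_zero_iff.1 hs.2.2)
    have h2 : primitiveWords stepWeight [DyckStep.U, DyckStep.D] (2 * 0) = ∅ :=
      Set.eq_empty_of_forall_notMem fun s hs => hs.1.1 (List.length_eq_zero_iff.1 hs.2.2)
    rw [h1, h2]
    exact Set.bijOn_empty _
  · rw [mul_one, primitiveWords_pair_one, primitiveWords_step_two, Set.bijOn_singleton]
    rfl
  · refine ⟨?_, ?_, ?_⟩
    · rintro s ⟨hs, -, rfl⟩
      obtain ⟨P, c, rfl⟩ := hs.exists_polyominoPiece hk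
      dsimp only
      rw [pieceComponent_polyominoPiece, length_polyominoPiece]
      have hlen := length_polyominoComponent hδ keep c P
      refine ⟨isPrimitive_polyominoComponent .., ?_, hlen⟩
      rw [length_polyominoPiece] at hk
      intro h
      rw [h] at hlen
      simp only [List.length_cons, List.length_nil] at hlen
      omega
    · rintro s ⟨hs, -, hks⟩ s' ⟨hs', -, hks'⟩ h
      obtain ⟨P, c, rfl⟩ := hs.exists_polyominoPiece (by omega)
      obtain ⟨P', c', rfl⟩ := hs'.exists_polyominoPiece (by omega)
      dsimp only at h
      rw [pieceComponent_polyominoPiece, pieceComponent_polyominoPiece] at h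
      obtain ⟨rfl, rfl⟩ := polyominoComponent_inj hδ h
      rfl
    · rintro l ⟨hl, -, hlen⟩
      obtain ⟨P, c, hP, rfl⟩ := exists_polyominoComponent_eq hδ keep hl hk hlen
      have hlen' := length_polyominoPiece P c
      refine ⟨polyominoPiece P c, ⟨isPrimitive_polyominoPiece P c, ?_, by omega⟩,
        pieceComponent_polyominoPiece ..⟩
      intro h
      rw [h] at hlen'
      simp only [List.length_cons, List.length_nil] at hlen'
      omega

/-! ### The bijection from pairs of compositions to paths -/

theorem bijOn_pairToPath {δ : ParallelogramPolyomino → DyckWord}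
    (hδ : IsPolyominoBijection δ) (keep : Colour) (n : ℕ) :
    Set.BijOn (pairToPath δ keep) (irreduciblePairs (n + 1)) (lowPeakFreePaths n) := by
  have h1 := bijOn_flatten isPrimitive_pair_EE n
  have h2 := bijOn_map_primitiveSeqs (bijOn_pieceComponent hδ keep) n even_length_of_isPrimitive
  have h3 := bijOn_flatten isPrimitive_UD (2 * n)
  rw [← lowPeakFreePaths_eq] at h3
  -- The inverse of `List.flatten` takes a word to its primitive factorization.
  have h4 := h1.symm h1.invOn_invFunOn.symm
  refine (((h3.comp h2).comp h4).comp (bijOn_pairWord n)).congr ?_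
  intro c hc
  -- Splitting at the common vertices computes this same factorization `L`, so the abstract
  -- composite agrees with `pairToPath`.
  obtain ⟨L, hL, hLc⟩ := h1.surjOn ((bijOn_pairWord n).mapsTo hc)
  simp only [Function.comp_apply]
  rw [← hLc, h1.invOn_invFunOn.1 hL, pairToPath, splitAtCommon]
  rw [pairWord] at hLc
  rw [← hLc, splitAux_flatten fun s hs => (hL.1 s hs).1, List.flatMap_map, List.flatMap_def]

/-! ### Polyominoes and Dyck paths -/

/-- The two steps of a Dyck path that stand for a pair of steps of the two boundary paths. -/
def pairSteps : NEStep × NEStep → List DyckStep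
  | (.N, .E) => [.U, .U]
  | (.E, .N) => [.D, .D]
  | (.N, .N) => [.U, .D]
  | (.E, .E) => [.D, .U]

/-- Interleave two paths, the second one with its steps exchanged. -/
def interleave (s : List (NEStep × NEStep)) : List DyckStep := s.flatMap pairSteps

@[simp] lemma interleave_nil : interleave [] = [] := rfl

@[simp] lemma interleave_cons (a : NEStep × NEStep) (s : List (NEStep × NEStep)) :
    interleave (a :: s) = pairSteps a ++ interleave s := rfl

@[simp] lemma length_pairSteps (a : NEStep × NEStep) : (pairSteps a).length = 2 := by
  obtain ⟨_ | _, _ | _⟩ := a <;> rfl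

@[simp] lemma length_interleave (s : List (NEStep × NEStep)) :
    (interleave s).length = 2 * s.length := by
  induction s with
  | nil => rfl
  | cons a s ih => simp [ih]; ring

lemma weight_interleave (s : List (NEStep × NEStep)) :
    weight stepWeight (interleave s) = 2 * weight pairWeight s := by
  induction s with
  | nil => rfl
  | cons a s ih =>
    obtain ⟨_ | _, _ | _⟩ := a <;> simp [ih, pairSteps, stepWeight, pairWeight] <;> ring

lemma take_interleave (s : List (NEStep × NEStep)) (i : ℕ) :
    (interleave s).take (2 * i) = interleave (s.take i) := by
  induction s generalizing i with
  | nil => simp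
  | cons a s ih =>
    cases i with
    | zero => simp
    | succ i =>
      rw [interleave_cons, List.take_append, length_pairSteps,
        List.take_of_length_le (by simp), List.take_succ_cons, interleave_cons, ← ih]
      rfl

lemma interleave_injective : Function.Injective interleave := by
  intro s t h
  induction s generalizing t with
  | nil =>
    have := congrArg List.length h
    simp at this
    simp [this]
  | cons a s ih =>
    cases t with
    | nil =>
      have := congrArg List.length h
      simp at this
    | cons b t =>
      obtain ⟨h1, h2⟩ := List.append_inj h (by simp)
      rw [ih h2]
      obtain ⟨_ | _, _ | _⟩ := a <;> obtain ⟨_ | _, _ | _⟩ := b <;> simp_all [pairSteps]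

lemma exists_interleave_eq : ∀ (k : ℕ) {l : List DyckStep}, l.length = 2 * k →
    ∃ s, interleave s = l
  | 0, [], _ => ⟨[], rfl⟩
  | k + 1, a :: b :: l, h => by
    obtain ⟨s, rfl⟩ := exists_interleave_eq k (l := l) (by simp at h; omega)
    cases a <;> cases b
    exacts [⟨(.N, .E) :: s, rfl⟩, ⟨(.N, .N) :: s, rfl⟩, ⟨(.E, .E) :: s, rfl⟩,
      ⟨(.E, .N) :: s, rfl⟩]
  | k + 1, [a], h => by simp at h; omega

/-- At even times the height is twice the gap between the paths, so at least 2 in the interior; at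
odd times it differs by at most 1 from such a value. Length 1 fails: `(E, E)` is vacuously positive,
but `DU` is not. -/
lemma isPositive_interleave_iff {s : List (NEStep × NEStep)} (hs : 2 ≤ s.length) :
    IsPositive stepWeight (interleave s) ↔ IsPositive pairWeight s := by
  have heven : ∀ i, weight stepWeight ((interleave s).take (2 * i)) =
      2 * weight pairWeight (s.take i) := fun i => by rw [take_interleave, weight_interleave]
  constructor
  · rintro ⟨h0, h⟩
    rw [weight_interleave] at h0
    refine ⟨by omega, fun i hi his => ?_⟩
    have := h (2 * i) (by omega) (by simpa using his)
    rw [heven] at this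
    omega
  · rintro ⟨h0, h⟩
    refine ⟨by rw [weight_interleave, h0, mul_zero], fun j hj hjs => ?_⟩
    rw [length_interleave] at hjs
    obtain ⟨i, rfl | rfl⟩ := j.even_or_odd'
    · have := h i (by omega) (by omega)
      rw [heven]
      omega
    -- An odd time is compared with the next even time. The last odd time uses the preceding one,
    -- which is interior because `s` has at least two letters.
    · by_cases hi : i + 1 < s.length
      · have h1 := h (i + 1) (by omega) hi
        have h2 := heven (i + 1)
        rw [show 2 * (i + 1) = 2 * i + 1 + 1 by ring, weight_take_succ _ (by simp; omega)] at h2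
        have := abs_le.1 (abs_stepWeight_le ((interleave s)[2 * i + 1]'(by simp; omega)))
        omega
      · have h1 := h i (by omega) (by omega)
        have h2 := heven i
        rw [weight_take_succ _ (by simp; omega)]
        have := abs_le.1 (abs_stepWeight_le ((interleave s)[2 * i]'(by simp; omega)))
        omega

/-- Interleaving the boundaries of a polyomino of semiperimeter `k` gives a nested Dyck path of
length `2 * k`; stripping its outer steps leaves size `k - 1`. -/
theorem exists_isPolyominoBijection :
    ∃ δ : ParallelogramPolyomino → DyckWord, IsPolyominoBijection δ := by
  have hex : ∀ P : ParallelogramPolyomino,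
      ∃ w : DyckWord, w.nest.toList = interleave (polyominoPiece P .blue) := by
    intro P
    have h := isPositive_polyominoPiece_blue P
    refine ((isPositive_interleave_iff h.1).2 h.2).exists_nest (List.ne_nil_of_length_pos ?_)
    rw [length_interleave]
    omega
  choose δ hδ using hex
  have hlen : ∀ P, (δ P).semilength + 1 = P.semiperimeter := by
    intro P
    have := length_nest (δ P)
    rw [hδ, length_interleave, length_polyominoPiece] at this
    omega
  refine ⟨δ, fun k hk => ⟨?_, ?_, ?_⟩⟩
  · rintro P rfl
    have := hlen P
    change (δ P).semilength = P.semiperimeter - 1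
    omega
  · rintro P - Q - h
    have h1 := hδ P
    rw [h, hδ] at h1
    have h2 := congrArg List.unzip (interleave_injective h1)
    rw [unzip_polyominoPiece_blue, unzip_polyominoPiece_blue] at h2
    cases P
    cases Q
    simp_all
  · intro w hw
    replace hw : w.semilength = k - 1 := hw
    have hl := length_nest w
    obtain ⟨s, hs⟩ := exists_interleave_eq k (l := w.nest.toList) (by omega)
    rw [← hs, length_interleave] at hl
    have hpos := isPositive_nest w
    rw [← hs, isPositive_interleave_iff (by omega)] at hpos
    refine ⟨⟨_, _, isParallelogram_iff.2 ⟨by omega, hpos⟩⟩, ?_, ?_⟩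
    · simp only [Set.mem_ofPred_eq, ParallelogramPolyomino.semiperimeter, List.length_map]
      omega
    · apply nest_injective
      dsimp only
      rw [hδ, ← hs, polyominoPiece]
      exact congrArg _ (List.zip_of_prod rfl rfl).symm

/-! ### Generating functions -/

lemma lowPeakFreePaths_finite (n : ℕ) : (lowPeakFreePaths n).Finite := by
  have : Finite DyckStep := Finite.of_surjective (fun b : Bool => if b then DyckStep.U else .D)
    fun s => by cases s; exacts [⟨true, rfl⟩, ⟨false, rfl⟩]
  rw [lowPeakFreePaths_eq]
  exact (List.finite_length_eq DyckStep (2 * n)).subset fun l hl => hl.1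

lemma ncard_semilength_eq (n : ℕ) : {w : DyckWord | w.semilength = n}.ncard = catalan n := by
  rw [← DyckWord.card_dyckWord_semilength_eq_catalan, ← Nat.card_eq_fintype_card]
  rfl

/-- The primitive words are elevated Dyck paths and their reflections, `catalan n` of each. The
correction term restores `UD`, which occurs among them only for `n = 0`. -/
lemma ncard_primitiveWords (n : ℕ) :
    (primitiveWords stepWeight [DyckStep.U, DyckStep.D] (2 * (n + 1))).ncard +
      (if n = 0 then 1 else 0) = 2 * catalan n := by
  set W : Set DyckWord := {w | w.semilength = n} with hW
  have hfin : W.Finite := (inferInstance : Finite {w : DyckWord // w.semilength = n})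
  set Q : Set (List DyckStep) := (fun w => w.nest.toList) '' W ∪
    (fun w => flipPath w.nest.toList) '' W with hQ
  have hQcard : Q.ncard = 2 * catalan n := by
    rw [hQ, Set.ncard_union_eq _ (hfin.image _) (hfin.image _),
      Set.ncard_image_of_injective _ nest_injective,
      Set.ncard_image_of_injective (f := fun w : DyckWord => flipPath w.nest.toList) _
        (flipPath_injective.comp nest_injective),
      ncard_semilength_eq]
    · ring
    · rw [Set.disjoint_left]
      rintro _ ⟨v, -, rfl⟩ ⟨w, -, h⟩
      exact nest_ne_flipPath_nest v w h.symm
  have hP : primitiveWords stepWeight [DyckStep.U, DyckStep.D] (2 * (n + 1)) =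
      Q \ {[DyckStep.U, DyckStep.D]} := by
    ext l
    simp only [primitiveWords, Set.mem_ofPred_eq, Set.mem_sdiff, Set.mem_singleton_iff]
    constructor
    · rintro ⟨h, hne, hlen⟩
      refine ⟨?_, hne⟩
      obtain ⟨w, rfl | rfl⟩ := h.exists_nest_or
      · rw [length_nest] at hlen
        exact .inl ⟨w, show w.semilength = n by omega, rfl⟩
      · rw [length_flipPath, length_nest] at hlen
        exact .inr ⟨w, show w.semilength = n by omega, rfl⟩
    · rintro ⟨⟨w, hw, rfl⟩ | ⟨w, hw, rfl⟩, hne⟩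
      · exact ⟨isPrimitive_nest w, hne, by rw [length_nest, hw]⟩
      · exact ⟨isPrimitive_flipPath.2 (isPrimitive_nest w), hne,
          by rw [length_flipPath, length_nest, hw]⟩
  have hQfin : Q.Finite := (hfin.image _).union (hfin.image _)
  rw [hP]
  split_ifs with hn
  · have hmem : [DyckStep.U, DyckStep.D] ∈ Q := .inl ⟨0, by simp [hW, hn], rfl⟩
    rw [Set.ncard_sdiff_singleton_add_one hmem hQfin, hQcard]
  · have hmem : [DyckStep.U, DyckStep.D] ∉ Q := by
      have hlen : ∀ l ∈ Q, l.length = 2 * (n + 1) := by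
        rintro _ (⟨w, hw, rfl⟩ | ⟨w, hw, rfl⟩)
        · rw [length_nest, hw]
        · rw [length_flipPath, length_nest, hw]
      intro h
      have := hlen _ h
      simp only [List.length_cons, List.length_nil] at this
      omega
    rw [Set.sdiff_singleton_eq_self hmem, hQcard, add_zero]

lemma ncard_lowPeakFreePaths (n : ℕ) : (lowPeakFreePaths n).ncard =
    (primitiveSeqs stepWeight [DyckStep.U, DyckStep.D] (2 * n)).ncard := by
  rw [lowPeakFreePaths_eq]
  exact (bijOn_flatten isPrimitive_UD _).ncard_eq.symm

lemma ncard_lowPeakFreePaths_zero : (lowPeakFreePaths 0).ncard = 1 := by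
  rw [Set.ncard_eq_one]
  refine ⟨[], ?_⟩
  rw [lowPeakFreePaths_eq]
  ext l
  simp only [avoidingWords, mul_zero, List.length_eq_zero_iff, Set.mem_ofPred_eq,
    Set.mem_singleton_iff, and_iff_left_iff_imp]
  rintro rfl
  simp

lemma ncard_lowPeakFreePaths_succ (n : ℕ) : (lowPeakFreePaths (n + 1)).ncard =
    ∑ ij ∈ Finset.HasAntidiagonal.antidiagonal n,
      (primitiveWords stepWeight [DyckStep.U, DyckStep.D] (2 * (ij.1 + 1))).ncard *
        (lowPeakFreePaths ij.2).ncard := by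
  have : Finite DyckStep := Finite.of_surjective (fun b : Bool => if b then DyckStep.U else .D)
    fun s => by cases s; exacts [⟨true, rfl⟩, ⟨false, rfl⟩]
  simp only [ncard_lowPeakFreePaths]
  exact card_primitiveSeqs_succ n even_length_of_isPrimitive

open PowerSeries in
theorem exists_sqrt_mk_lowPeakFreePaths :
    ∃ S : PowerSeries ℚ, constantCoeff S = 1 ∧ S ^ 2 = 1 - 4 * X ∧
      mk (fun n => ((lowPeakFreePaths n).ncard : ℚ)) = (X + S)⁻¹ := by
  set C : PowerSeries ℚ := PowerSeries.map (Nat.castRingHom ℚ) catalanSeries with hC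
  have hCeq : C ^ 2 * X + 1 = C := by
    have := congrArg (PowerSeries.map (Nat.castRingHom ℚ)) catalanSeries_sq_mul_X_add_one
    simpa using this
  set F : PowerSeries ℚ := mk (fun n => ((lowPeakFreePaths n).ncard : ℚ)) with hF
  -- A nonempty path is a first primitive factor followed by a path; `2 * C - 1` counts the
  -- admissible first factors.
  have hrec : F = 1 + X * ((2 * C - 1) * F) := by
    ext n
    cases n with
    | zero => simp [hF, ncard_lowPeakFreePaths_zero]
    | succ n =>
      rw [map_add, coeff_succ_X_mul, coeff_mul, hF, coeff_mk, ncard_lowPeakFreePaths_succ]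
      simp only [coeff_one, Nat.succ_ne_zero, if_false, zero_add, Nat.cast_sum, Nat.cast_mul]
      refine Finset.sum_congr rfl fun ij _ => ?_
      rw [coeff_mk]
      congr 1
      have h := congrArg (Nat.cast : ℕ → ℚ) (ncard_primitiveWords ij.1)
      push_cast at h
      have h2 : coeff ij.1 (2 * C) = 2 * (catalan ij.1 : ℚ) := by
        rw [two_mul, map_add, hC]
        simp
        ring
      rw [map_sub, h2, coeff_one, ← h]
      ring
  -- This root comes from solving the quadratic `C = 1 + X * C ^ 2`; the recursion then reads `F *
  -- (X + S) = 1`.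
  refine ⟨1 - 2 * X * C, by simp, ?_, ?_⟩
  · linear_combination (4 * X : PowerSeries ℚ) * hCeq
  · rw [PowerSeries.eq_inv_iff_mul_eq_one (by simp)]
    linear_combination hrec

end LatticePairs

/-! ### The main theorem -/

theorem mainTheorem3 :
    -- irreducible pairs of compositions of n + 1 and low-peak-free paths of size n: equinumerous
    (∀ n : ℕ, (LatticePairs.lowPeakFreePaths n).Finite ∧
      (LatticePairs.irreduciblePairs (n + 1)).ncard = (LatticePairs.lowPeakFreePaths n).ncard) ∧
    -- both generating functions are 1 / (x + √(1 - 4x))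
    (∃ S : PowerSeries ℚ, PowerSeries.constantCoeff S = 1 ∧ S ^ 2 = 1 - 4 * PowerSeries.X ∧
      PowerSeries.mk (fun n => ((LatticePairs.irreduciblePairs (n + 1)).ncard : ℚ)) =
        (PowerSeries.X + S)⁻¹ ∧
      PowerSeries.mk (fun n => ((LatticePairs.lowPeakFreePaths n).ncard : ℚ)) =
        (PowerSeries.X + S)⁻¹) ∧
    -- bijections from parallelogram polyominoes to Dyck paths exist,
    (∃ δ : LatticePairs.ParallelogramPolyomino → DyckWord, LatticePairs.IsPolyominoBijection δ) ∧
    -- and any of them, with either colour convention, yields the explicit bijection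
    (∀ δ : LatticePairs.ParallelogramPolyomino → DyckWord, LatticePairs.IsPolyominoBijection δ →
      ∀ (keep : LatticePairs.Colour) (n : ℕ),
        Set.BijOn (LatticePairs.pairToPath δ keep)
          (LatticePairs.irreduciblePairs (n + 1)) (LatticePairs.lowPeakFreePaths n)) := by
  -- Equinumerosity does not mention `δ`, so it needs some `δ` to exist before the explicit
  -- bijection can be used.
  obtain ⟨δ, hδ⟩ := LatticePairs.exists_isPolyominoBijection
  have hcard : ∀ n, (LatticePairs.irreduciblePairs (n + 1)).ncard =
      (LatticePairs.lowPeakFreePaths n).ncard := fun n =>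
    (LatticePairs.bijOn_pairToPath hδ .blue n).ncard_eq
  obtain ⟨S, hS1, hS2, hS⟩ := LatticePairs.exists_sqrt_mk_lowPeakFreePaths
  refine ⟨fun n => ⟨LatticePairs.lowPeakFreePaths_finite n, hcard n⟩,
    ⟨S, hS1, hS2, ?_, hS⟩, ⟨δ, hδ⟩, fun _ => LatticePairs.bijOn_pairToPath⟩
  simp only [hcard, hS]
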